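/- Let $B\subset A$ be an inclusion of (not necessarily unital) $C^*$-algebras and let $E:A\to B$ be a conditional expectation, i.e. a positive linear $B$-bimodule map that restricts to the identity on $B$. Suppose that $E$ has finite probabilistic index, i.e. there is a scalar $\gamma\ge 1$ such that $\gamma E-\mathrm{id}_A$ is positive. Regard $A$ as a right $B$-module with the $B$-valued inner product $\langle x,y\rangle_B=E(x^*y)$, let $\mathfrak A$ be its Hilbert $C^*$-module completion with respect to the norm $\|E(x^*x)\|^{1/2}$, and let $\eta:A\to\mathfrak A$ be the canonical map. Let $\mathcal L_B(\mathfrak A)$ be the $C^*$-algebra of adjointable operators on $\mathfrak A$, let $\lambda:A\to\mathcal L_B(\mathfrak A)$ be the $*$-homomorphism given by $\lambda(a)\eta(x)=\eta(ax)$, let $e_E\in\mathcal L_B(\mathfrak A)$ be the projection given by $e_E\eta(x)=\eta(E(x))$, and let $C^*_r\langle A,e_E\rangle$ be the norm closure in $\mathcal L_B(\mathfrak A)$ of $\mathrm{span}\{\lambda(x)e_E\lambda(y):x,y\in A\}$. Then the following hold. 1. $\eta:A\to\mathfrak A$ is a linear contraction: $\|\eta(a)\|\le\|a\|$ for all $a\in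 A$. 2. $A$ itself is a Hilbert $C^*$-module over $B$: $\eta$ is injective, $A$ is complete with respect to the norm $\|E(x^*x)\|^{1/2}$, and $\mathfrak A=\eta(A)$. 3. $A=AB$, i.e. every $a\in A$ is of the form $a=xb$ with $x\in A$ and $b\in B$. In particular, every approximate identity for $B$ is an approximate identity for $A$. 4. $\{e_E\}'\cap\lambda(A)=\lambda(B)$ in $\mathcal L_B(\mathfrak A)$. 5. $\lambda(A)e_E\cup e_E\lambda(A)\subseteq C^*_r\langle A,e_E\rangle$. 6. The map $\psi:B\to C^*_r\langle A,e_E\rangle$, $\psi(b)=\lambda(b)e_E$, is an injective $*$-homomorphism. -/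

import Mathlib

noncomputable section

/-! ### Right Hilbert modules and adjointable operators -/

lemma norm_sq_le_of_quadratic {B : Type*} [NonUnitalCStarAlgebra B] [PartialOrder B]
    [StarOrderedRing B] {g h c : B} (hg : 0 ≤ g)
    (H : ∀ t : ℝ, 0 ≤ h - t • (star c * c) - t • (star c * c) + (t * t) • (star c * (g * c))) :
    ‖c‖ ^ 2 ≤ ‖g‖ * ‖h‖ := by
  have key : ∀ N : ℝ, 0 < N → ‖g‖ ≤ N → ‖c‖ ^ 2 ≤ N * ‖h‖ := by
    intro N hN hgN
    have h0 : (0 : B) ≤ star c * c := star_mul_self_nonneg c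
    have h1 : star c * (g * c) ≤ N • (star c * c) := by
      rw [← mul_assoc]
      exact (CStarAlgebra.star_left_conjugate_le_norm_smul (.of_nonneg hg)).trans
        (smul_le_smul_of_nonneg_right hgN h0)
    have h2 : N⁻¹ • (star c * c) ≤ h := by
      rw [← sub_nonneg]
      refine (H N⁻¹).trans ?_
      have h3 := smul_le_smul_of_nonneg_left h1 (a := N⁻¹ * N⁻¹) (by positivity)
      rw [smul_smul, mul_assoc, inv_mul_cancel₀ hN.ne', mul_one] at h3
      calc _ ≤ h - N⁻¹ • (star c * c) - N⁻¹ • (star c * c) + N⁻¹ • (star c * c) := by gcongr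
        _ = _ := by abel
    have h4 := CStarAlgebra.norm_le_norm_of_nonneg_of_le (smul_nonneg (by positivity) h0) h2
    rw [norm_smul, CStarRing.norm_star_mul_self, norm_inv, Real.norm_of_nonneg hN.le,
      inv_mul_le_iff₀ hN] at h4
    rwa [sq]
  refine le_of_forall_pos_le_add fun ε hε => ?_
  have h5 : ε / (‖h‖ + 1) * ‖h‖ ≤ ε := by
    rw [div_mul_eq_mul_div, div_le_iff₀ (by positivity)]
    nlinarith [norm_nonneg h]
  have h6 := key (‖g‖ + ε / (‖h‖ + 1)) (by positivity) (le_add_of_nonneg_right (by positivity))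
  rw [add_mul] at h6
  linarith

/-- `X` is a (right) Hilbert C⋆-module over the C⋆-algebra `B`: a Banach space with a right action
of `B`, written as an action of `Bᵐᵒᵖ`, and a `B`-valued inner product, linear in the second
variable, such that `‖x‖² = ‖⟪x, x⟫‖`. (Mathlib's `CStarModule` is the version for left actions.)
Definiteness of the inner product and the additivity and associativity of the action are
consequences, since `X` is a normed group. -/
class RightHilbertModule (B X : Type*) [NonUnitalCStarAlgebra B] [PartialOrder B]
    [NormedAddCommGroup X] [NormedSpace ℂ X] [SMul Bᵐᵒᵖ X] [Inner B X] : Prop where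
  complete : CompleteSpace X
  inner_add_right (x y z : X) : inner B x (y + z) = inner B x y + inner B x z
  inner_smul_right (c : ℂ) (x y : X) : inner B x (c • y) = c • inner B x y
  inner_op_smul_right (b : B) (x y : X) : inner B x (MulOpposite.op b • y) = inner B x y * b
  star_inner (x y : X) : star (inner B x y) = inner B y x
  inner_self_nonneg (x : X) : 0 ≤ inner B x x
  norm_sq_eq (x : X) : ‖x‖ ^ 2 = ‖inner B x x‖

namespace RightHilbertModule

variable (B X : Type*) [NonUnitalCStarAlgebra B] [PartialOrder B]
  [NormedAddCommGroup X] [NormedSpace ℂ X] [SMul Bᵐᵒᵖ X] [Inner B X] [RightHilbertModule B X]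

variable {X} in
lemma inner_add_left (x y z : X) : inner B (x + y) z = inner B x z + inner B y z := by
  rw [← star_inner, inner_add_right, star_add, star_inner, star_inner]

variable {X} in
lemma inner_smul_left (c : ℂ) (x y : X) : inner B (c • x) y = star c • inner B x y := by
  rw [← star_inner, inner_smul_right, star_smul, star_inner]

variable {X} in
lemma inner_zero_right (x : X) : inner B x 0 = 0 := by
  simpa using inner_smul_right (B := B) 0 x 0

variable {X} in
lemma inner_sub_right (x y z : X) : inner B x (y - z) = inner B x y - inner B x z := by
  rw [eq_sub_iff_add_eq, ← inner_add_right, sub_add_cancel]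

variable {X} in
lemma inner_sub_left (x y z : X) : inner B (x - y) z = inner B x z - inner B y z := by
  rw [eq_sub_iff_add_eq, ← inner_add_left, sub_add_cancel]

variable {X} in
lemma ext_inner {y z : X} (h : ∀ x, inner B x y = inner B x z) : y = z := by
  have h1 := norm_sq_eq (B := B) (y - z)
  rw [inner_sub_right, h, sub_self, norm_zero] at h1
  exact sub_eq_zero.1 (norm_eq_zero.1 (pow_eq_zero_iff two_ne_zero |>.1 h1))

/-- The operators on `X` that have an adjoint, as a subalgebra of the bounded operators on `X`. -/
def adjointableSubalgebra : Subalgebra ℂ (X →L[ℂ] X) where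
  carrier := {T | ∃ S : X →L[ℂ] X, ∀ x y, inner B (T x) y = inner B x (S y)}
  mul_mem' := by
    rintro T T' ⟨S, hS⟩ ⟨S', hS'⟩
    exact ⟨S' * S, fun x y => by simp [hS, hS']⟩
  add_mem' := by
    rintro T T' ⟨S, hS⟩ ⟨S', hS'⟩
    exact ⟨S + S', fun x y => by simp [hS, hS', inner_add_left, inner_add_right]⟩
  algebraMap_mem' c := ⟨algebraMap ℂ _ (star c), fun x y => by
    simp [Algebra.algebraMap_eq_smul_one, inner_smul_left, inner_smul_right]⟩

variable {X} in
/-- The Cauchy–Schwarz inequality. -/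
lemma norm_inner_le [StarOrderedRing B] (x y : X) : ‖inner B x y‖ ≤ ‖x‖ * ‖y‖ := by
  refine le_of_sq_le_sq ?_ (by positivity)
  rw [mul_pow, norm_sq_eq (B := B) x, norm_sq_eq (B := B) y]
  refine norm_sq_le_of_quadratic (inner_self_nonneg x) fun t => ?_
  have h := inner_self_nonneg (B := B) (y - (t : ℂ) • (MulOpposite.op (inner B x y) • x))
  have e1 : ∀ w, inner B w ((t : ℂ) • (MulOpposite.op (inner B x y) • x)) =
      t • (inner B w x * inner B x y) := fun w => by
    rw [inner_smul_right, inner_op_smul_right, Complex.coe_smul]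
  have e2 : ∀ w, inner B ((t : ℂ) • (MulOpposite.op (inner B x y) • x)) w =
      t • (star (inner B x y) * inner B x w) := fun w => by
    rw [← star_inner w, e1, star_smul, star_mul, star_inner w x, star_trivial]
  simp only [inner_sub_right, inner_sub_left, e1, e2] at h
  refine h.trans_eq ?_
  rw [← star_inner x y]
  simp only [sub_mul, smul_sub, smul_smul, smul_mul_assoc, mul_assoc]
  abel

/-- The boundedness built into `adjointableSubalgebra` is automatic: if two linear maps are adjoint to each
other, then they are continuous, by the closed graph theorem. -/
lemma continuous_of_adjoint [StarOrderedRing B] (T S : X →ₗ[ℂ] X)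
    (h : ∀ x y, inner B (T x) y = inner B x (S y)) : Continuous S := by
  have : CompleteSpace X := complete B
  have hc : ∀ x : X, Continuous fun y : X => inner B x y := fun x =>
    (LinearMap.mkContinuous (σ := RingHom.id ℂ) ⟨⟨fun y => inner B x y, inner_add_right x⟩,
      fun c y => inner_smul_right c x y⟩ ‖x‖ fun y => norm_inner_le B x y).continuous
  refine S.continuous_of_seq_closed_graph fun u x y hu hSu => ?_
  refine ext_inner B fun z => ?_
  have h1 := ((hc z).tendsto y).comp hSu
  have h2 := ((hc (T z)).tendsto x).comp hu
  rw [← h]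
  refine tendsto_nhds_unique h1 (h2.congr fun n => ?_)
  simp [h]

/-- The unital C⋆-algebra `L_B(X)` of adjointable operators on `X`, with the operator norm. -/
def Adjointable : Type _ := adjointableSubalgebra B X

namespace Adjointable

variable {B X}

instance : NormedRing (Adjointable B X) := inferInstanceAs (NormedRing (adjointableSubalgebra B X))

instance : NormedAlgebra ℂ (Adjointable B X) :=
  inferInstanceAs (NormedAlgebra ℂ (adjointableSubalgebra B X))

/-- The adjoint of an adjointable operator. -/
instance : Star (Adjointable B X) where
  star T := ⟨T.2.choose, T.1, fun x y => by
    rw [← star_inner, ← T.2.choose_spec, star_inner]⟩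

lemma inner_star_right (T : Adjointable B X) (x y : X) :
    inner B x ((star T).1 y) = inner B (T.1 x) y :=
  (T.2.choose_spec x y).symm

lemma star_eq_of_inner {T S : Adjointable B X}
    (h : ∀ x y, inner B (T.1 x) y = inner B x (S.1 y)) : star T = S := by
  refine Subtype.ext (ContinuousLinearMap.ext fun y => ext_inner B fun x => ?_)
  rw [inner_star_right, h]

instance : StarRing (Adjointable B X) where
  star_involutive T := star_eq_of_inner fun x y => by
    rw [← star_inner, inner_star_right, star_inner]
  star_mul T S := star_eq_of_inner fun x y => by
    change inner B (T.1 (S.1 x)) y = inner B x ((star S).1 ((star T).1 y))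
    rw [inner_star_right, inner_star_right]
  star_add T S := star_eq_of_inner fun x y => by
    change inner B (T.1 x + S.1 x) y = inner B x ((star T).1 y + (star S).1 y)
    rw [inner_add_left, inner_add_right, inner_star_right, inner_star_right]

instance : StarModule ℂ (Adjointable B X) where
  star_smul c T := star_eq_of_inner fun x y => by
    change inner B (c • T.1 x) y = inner B x (star c • (star T).1 y)
    rw [inner_smul_left, inner_smul_right, inner_star_right]

lemma norm_sq_le [StarOrderedRing B] (T : Adjointable B X) : ‖T‖ ^ 2 ≤ ‖star T * T‖ := by
  have h : ‖T.1‖ ≤ √‖star T * T‖ := by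
    refine T.1.opNorm_le_bound (by positivity) fun x => ?_
    refine le_of_sq_le_sq ?_ (by positivity)
    rw [mul_pow, Real.sq_sqrt (norm_nonneg (star T * T)), norm_sq_eq (B := B), ← inner_star_right]
    calc _ ≤ ‖x‖ * ‖(star T * T).1 x‖ := norm_inner_le B x _
      _ ≤ ‖x‖ * (‖star T * T‖ * ‖x‖) := by gcongr; exact (star T * T).1.le_opNorm x
      _ = _ := by ring
  calc ‖T‖ ^ 2 ≤ √‖star T * T‖ ^ 2 := by gcongr; exact h
    _ = _ := Real.sq_sqrt (norm_nonneg _)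

instance instCStarRing [StarOrderedRing B] : CStarRing (Adjointable B X) where
  norm_mul_self_le T := by rw [← sq]; exact norm_sq_le T

instance instNormedStarGroup [StarOrderedRing B] : NormedStarGroup (Adjointable B X) :=
  CStarRing.to_normedStarGroup

instance instCompleteSpace [StarOrderedRing B] : CompleteSpace (Adjointable B X) := by
  have : CompleteSpace X := complete B
  refine Metric.complete_of_cauchySeq_tendsto fun u hu => ?_
  have hval : UniformContinuous fun T : Adjointable B X => T.1 := uniformContinuous_subtype_val
  have hstar : UniformContinuous fun T : Adjointable B X => (star T).1 :=
    hval.comp (LipschitzWith.of_dist_le_mul (K := 1) fun T S => by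
      rw [dist_eq_norm, dist_eq_norm, ← star_sub, norm_star, NNReal.coe_one,
        one_mul]).uniformContinuous
  obtain ⟨T, hT⟩ := cauchySeq_tendsto_of_complete (hval.comp_cauchySeq hu)
  obtain ⟨S, hS⟩ := cauchySeq_tendsto_of_complete (hstar.comp_cauchySeq hu)
  have hc : ∀ x : X, Continuous fun y : X => inner B x y := fun x =>
    (LinearMap.mkContinuous (σ := RingHom.id ℂ) ⟨⟨fun y => inner B x y, inner_add_right x⟩,
      fun c y => inner_smul_right c x y⟩ ‖x‖ fun y => norm_inner_le B x y).continuous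
  have hTS : ∀ x y, inner B (T x) y = inner B x (S y) := fun x y => by
    have h1 := ((hc x).tendsto _).comp
      (((ContinuousLinearMap.apply ℂ X y).continuous.tendsto S).comp hS)
    have h2 := (((hc y).tendsto _).comp
      (((ContinuousLinearMap.apply ℂ X x).continuous.tendsto T).comp hT)).star
    simp only [star_inner] at h2
    refine tendsto_nhds_unique (h2.congr fun n => ?_) h1
    simp [star_inner, inner_star_right]
  exact ⟨⟨T, S, hTS⟩, tendsto_subtype_rng.2 hT⟩

instance [StarOrderedRing B] : CStarAlgebra (Adjointable B X) where

end Adjointable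

end RightHilbertModule

/-! ### Conditional expectations -/

/-- The order that a C⋆-subalgebra inherits is the usual order of C⋆-algebras. -/
instance NonUnitalStarSubalgebra.starOrderedRing_of_isClosed {A : Type*}
    [NonUnitalCStarAlgebra A] [PartialOrder A] [StarOrderedRing A] (B : NonUnitalStarSubalgebra ℂ A)
    [IsClosed (B : Set A)] : StarOrderedRing B :=
  StarOrderedRing.of_nonneg_iff'
    (fun {x y} h z => by
      change (z : A) + x ≤ z + y
      have h' : (x : A) ≤ y := h
      gcongr)
    (fun x => by
      constructor
      · intro h
        have h' : (0 : A) ≤ x := h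
        have hmem : CFC.sqrt (x : A) ∈ B := by
          rw [CFC.sqrt_eq_real_sqrt (x : A) h']
          exact cfcₙ_mem (𝕜' := ℂ) _ x.2
        refine ⟨⟨_, hmem⟩, Subtype.ext ?_⟩
        change (x : A) = star (CFC.sqrt (x : A)) * CFC.sqrt (x : A)
        rw [(CFC.sqrt_nonneg (x : A)).isSelfAdjoint.star_eq, CFC.sqrt_mul_sqrt_self (x : A) h']
      · rintro ⟨s, rfl⟩
        exact star_mul_self_nonneg (s : A))

/-- A conditional expectation of the C⋆-algebra `A` onto the C⋆-subalgebra `B`: a positive linear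
`B`-bimodule map `A → B` that restricts to the identity on `B`. (Contractivity and complete
positivity are consequences, so they are not required.) -/
structure ConditionalExpectation {A : Type*} [NonUnitalCStarAlgebra A] [PartialOrder A]
    (B : NonUnitalStarSubalgebra ℂ A) extends A →ₗ[ℂ] B where
  map_nonneg' (a : A) : 0 ≤ a → 0 ≤ toFun a
  map_coe' (b : B) : toFun b = b
  map_mul_left' (b : B) (a : A) : toFun (b * a) = b * toFun a
  map_mul_right' (a : A) (b : B) : toFun (a * b) = toFun a * b

namespace ConditionalExpectation

set_option linter.unusedSectionVars false

section Basic

variable {A : Type*} [NonUnitalCStarAlgebra A] [PartialOrder A] {B : NonUnitalStarSubalgebra ℂ A}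

instance : CoeFun (ConditionalExpectation B) fun _ => A → B := ⟨fun E => E.toLinearMap⟩

/-- `E` has finite probabilistic index: `γ E - id` is positive for some scalar `γ ≥ 1`. -/
def HasFiniteProbabilisticIndex (E : ConditionalExpectation B) : Prop :=
  ∃ γ : ℝ, 1 ≤ γ ∧ ∀ a : A, 0 ≤ a → 0 ≤ γ • (E a : A) - a

variable (E : ConditionalExpectation B)

lemma map_nonneg {a : A} (h : 0 ≤ a) : 0 ≤ E a := E.map_nonneg' a h
lemma map_coe (b : B) : E b = b := E.map_coe' b
lemma map_mul_left (b : B) (a : A) : E (b * a) = b * E a := E.map_mul_left' b a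
lemma map_mul_right (a : A) (b : B) : E (a * b) = E a * b := E.map_mul_right' a b

end Basic

variable {A : Type*} [NonUnitalCStarAlgebra A] [PartialOrder A] [StarOrderedRing A]
  {B : NonUnitalStarSubalgebra ℂ A} (E : ConditionalExpectation B)

lemma map_mono {a b : A} (h : a ≤ b) : E a ≤ E b := by
  have h1 := E.map_nonneg (sub_nonneg.2 h)
  rwa [map_sub, sub_nonneg] at h1

lemma map_star (a : A) : E (star a) = star (E a) := by
  obtain ⟨y, hy, -, hsum⟩ := CStarAlgebra.exists_sum_four_nonneg a
  have h1 : ∀ i, star (y i) = y i := fun i => (IsSelfAdjoint.of_nonneg (hy i)).star_eq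
  have h2 : ∀ i, star (E (y i)) = E (y i) := fun i => Subtype.ext
    (IsSelfAdjoint.of_nonneg (show (0 : A) ≤ (E (y i) : A) from E.map_nonneg (hy i))).star_eq
  rw [hsum]
  simp [star_sum, star_smul, h1, h2]

/-! ### The Hilbert module completion of `A` with respect to `E` -/

/-- `A` regarded as the (right) semi-inner product `B`-module with `⟪x, y⟫ = E (x⋆ y)`; it carries
the seminorm `‖E (x⋆ x)‖ ^ (1/2)` and not the norm of `A`. -/
def PreModule (_E : ConditionalExpectation B) : Type _ := A

namespace PreModule

variable {E}

instance : AddCommGroup E.PreModule := inferInstanceAs (AddCommGroup A)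
instance : Module ℂ E.PreModule := inferInstanceAs (Module ℂ A)

variable (E) in
/-- The identity map of `A`, as a map to `E.PreModule`. -/
def of : A ≃ₗ[ℂ] E.PreModule := LinearEquiv.refl ℂ A

/-- The right action of `B` on `A` by multiplication. -/
instance : SMul Bᵐᵒᵖ E.PreModule := ⟨fun b x => of E ((of E).symm x * (b.unop : A))⟩

/-- The inner product `⟪x, y⟫ = E (x⋆ y)`. -/
instance : Inner B E.PreModule := ⟨fun x y => E (star ((of E).symm x) * (of E).symm y)⟩

lemma inner_def (x y : E.PreModule) :
    inner B x y = E (star ((of E).symm x) * (of E).symm y) := rfl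

lemma inner_add_right (x y z : E.PreModule) :
    inner B x (y + z) = inner B x y + inner B x z := by simp [inner_def, mul_add]

lemma inner_smul_right (c : ℂ) (x y : E.PreModule) :
    inner B x (c • y) = c • inner B x y := by
  rw [inner_def, map_smul, mul_smul_comm, map_smul, inner_def]

lemma inner_op_smul_right (b : B) (x y : E.PreModule) :
    inner B x (MulOpposite.op b • y) = inner B x y * b := by
  change E (star ((of E).symm x) * ((of E).symm y * b)) = _
  rw [← mul_assoc, map_mul_right, inner_def]

lemma star_inner (x y : E.PreModule) : star (inner B x y) = inner B y x := by
  simp [inner_def, ← map_star]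

lemma inner_self_nonneg (x : E.PreModule) : 0 ≤ inner B x x :=
  E.map_nonneg (star_mul_self_nonneg _)

lemma inner_add_left (x y z : E.PreModule) :
    inner B (x + y) z = inner B x z + inner B y z := by simp [inner_def, add_mul]

lemma inner_smul_left (c : ℂ) (x y : E.PreModule) :
    inner B (c • x) y = star c • inner B x y := by
  rw [inner_def, map_smul, star_smul, smul_mul_assoc, map_smul, inner_def]

instance : Norm E.PreModule := ⟨fun x => √‖inner B x x‖⟩

lemma norm_def (x : E.PreModule) : ‖x‖ = √‖inner B x x‖ := rfl

lemma norm_sq_eq (x : E.PreModule) : ‖x‖ ^ 2 = ‖inner B x x‖ := Real.sq_sqrt (norm_nonneg _)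

variable [IsClosed (B : Set A)]

lemma norm_inner_le (x y : E.PreModule) : ‖inner B x y‖ ≤ ‖x‖ * ‖y‖ := by
  refine le_of_sq_le_sq ?_ (mul_nonneg (Real.sqrt_nonneg _) (Real.sqrt_nonneg _))
  rw [mul_pow, norm_sq_eq x, norm_sq_eq y]
  refine norm_sq_le_of_quadratic (inner_self_nonneg x) fun t => ?_
  have h := inner_self_nonneg (y - (t : ℂ) • (MulOpposite.op (inner B x y) • x))
  have s1 : ∀ w u v : E.PreModule, inner B w (u - v) = inner B w u - inner B w v :=
    fun w u v => by simp [inner_def, mul_sub]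
  have s2 : ∀ w u v : E.PreModule, inner B (u - v) w = inner B u w - inner B v w :=
    fun w u v => by simp [inner_def, sub_mul]
  have e1 : ∀ w, inner B w ((t : ℂ) • (MulOpposite.op (inner B x y) • x)) =
      t • (inner B w x * inner B x y) := fun w => by
    rw [inner_smul_right, inner_op_smul_right, Complex.coe_smul]
  have e2 : ∀ w, inner B ((t : ℂ) • (MulOpposite.op (inner B x y) • x)) w =
      t • (star (inner B x y) * inner B x w) := fun w => by
    rw [← star_inner w, e1, star_smul, star_mul, star_inner w x, star_trivial]
  simp only [s1, s2, e1, e2] at h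
  refine h.trans_eq ?_
  rw [← star_inner x y]
  simp only [smul_smul, smul_mul_assoc, mul_assoc]
  abel

lemma core : SeminormedSpace.Core ℂ E.PreModule where
  norm_nonneg _ := Real.sqrt_nonneg _
  norm_smul c x := by
    rw [norm_def, inner_smul_left, inner_smul_right, smul_smul, norm_smul, norm_mul, norm_star,
      Real.sqrt_mul (by positivity), Real.sqrt_mul_self (norm_nonneg _), norm_def]
  norm_triangle x y := by
    refine le_of_sq_le_sq ?_ (add_nonneg (Real.sqrt_nonneg _) (Real.sqrt_nonneg _))
    rw [norm_sq_eq, inner_add_left, inner_add_right, inner_add_right]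
    have h1 := norm_inner_le x y
    have h2 := norm_inner_le y x
    have h3 := norm_sq_eq x
    have h4 := norm_sq_eq y
    have h5 := norm_add_le (inner B x x + inner B x y) (inner B y x + inner B y y)
    have h6 := norm_add_le (inner B x x) (inner B x y)
    have h7 := norm_add_le (inner B y x) (inner B y y)
    nlinarith

instance : SeminormedAddCommGroup E.PreModule := SeminormedAddCommGroup.ofCore (𝕜 := ℂ) core

instance : NormedSpace ℂ E.PreModule where
  norm_smul_le c x := (core.norm_smul c x).le

lemma norm_le_of_inner_le {x y : E.PreModule} {C : ℝ} (hC : 0 ≤ C)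
    (h : inner B x x ≤ (C ^ 2) • inner B y y) : ‖x‖ ≤ C * ‖y‖ := by
  refine le_of_sq_le_sq ?_ (mul_nonneg hC (norm_nonneg _))
  rw [mul_pow, norm_sq_eq, norm_sq_eq]
  refine (CStarAlgebra.norm_le_norm_of_nonneg_of_le (inner_self_nonneg x) h).trans ?_
  rw [norm_smul, Real.norm_of_nonneg (by positivity)]

lemma norm_op_smul_le (b : Bᵐᵒᵖ) (x : E.PreModule) : ‖b • x‖ ≤ ‖b.unop‖ * ‖x‖ := by
  refine le_of_sq_le_sq ?_ (by positivity)
  rw [mul_pow, norm_sq_eq, norm_sq_eq]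
  have h : inner B (b • x) (b • x) = star b.unop * inner B x x * b.unop := by
    rw [← MulOpposite.op_unop b, inner_op_smul_right, ← star_inner, inner_op_smul_right, star_mul,
      star_inner, MulOpposite.op_unop]
  rw [h]
  calc _ ≤ ‖star b.unop‖ * ‖inner B x x‖ * ‖b.unop‖ :=
        (norm_mul_le _ _).trans (by gcongr; exact norm_mul_le _ _)
    _ = _ := by rw [norm_star]; ring

instance : UniformContinuousConstSMul Bᵐᵒᵖ E.PreModule where
  uniformContinuous_const_smul b := by
    let f : E.PreModule →+ E.PreModule :=
      ⟨⟨fun x => b • x, by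
        change of E ((of E).symm 0 * _) = 0; simp⟩,
        fun x y => by
          change of E ((of E).symm (x + y) * _) = of E (_ * _) + of E (_ * _)
          simp [add_mul]⟩
    exact (AddMonoidHomClass.lipschitz_of_bound f _ (norm_op_smul_le b)).uniformContinuous

end PreModule

variable [IsClosed (B : Set A)]

/-- The Hilbert `B`-module `𝔄`: the (Hausdorff) completion of `A` with respect to the norm
`‖E (x⋆ x)‖ ^ (1/2)`, with the extended inner product and the extended right action of `B`. -/
abbrev HilbertModule : Type _ := UniformSpace.Completion E.PreModule

/-- The canonical map `η : A → 𝔄`. -/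
def eta : A →ₗ[ℂ] E.HilbertModule :=
  (UniformSpace.Completion.toComplL (𝕜 := ℂ) (E := E.PreModule)).toLinearMap ∘ₗ
    (PreModule.of E).toLinearMap

namespace HilbertModule

variable {E}

open UniformSpace

lemma pre_continuous_inner :
    Continuous (Function.uncurry (inner B : E.PreModule → E.PreModule → B)) := by
  let f : E.PreModule →L⋆[ℂ] E.PreModule →L[ℂ] B :=
    LinearMap.mkContinuous₂ (LinearMap.mk₂'ₛₗ (starRingEnd ℂ) (RingHom.id ℂ)
      (fun x y => inner B x y) PreModule.inner_add_left PreModule.inner_smul_left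
      PreModule.inner_add_right PreModule.inner_smul_right) 1
      fun x y => by simpa using PreModule.norm_inner_le x y
  exact (f.continuous.comp continuous_fst).clm_apply continuous_snd

lemma inner_coe (x y : E.PreModule) :
    inner B (x : E.HilbertModule) (y : E.HilbertModule) = inner B x y :=
  (Completion.isDenseInducing_coe.prodMap Completion.isDenseInducing_coe).extend_eq
    pre_continuous_inner (x, y)

lemma continuous_inner :
    Continuous (Function.uncurry (inner B : E.HilbertModule → E.HilbertModule → B)) := by
  let inner' : E.PreModule →+ E.PreModule →+ B :=
    { toFun := fun x => ⟨⟨fun y => inner B x y, by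
        simpa using PreModule.inner_smul_right 0 x 0⟩, PreModule.inner_add_right x⟩
      map_zero' := by ext y : 1; simpa using PreModule.inner_smul_left 0 0 y
      map_add' := fun x y => by ext z : 1; exact PreModule.inner_add_left x y z }
  have : Continuous fun p : E.PreModule × E.PreModule => inner' p.1 p.2 := pre_continuous_inner
  exact (Completion.isDenseInducing_toCompl E.PreModule).extend_Z_bilin
    (Completion.isDenseInducing_toCompl E.PreModule) this

lemma continuous_inner_comp {α : Type*} [TopologicalSpace α] {f g : α → E.HilbertModule}
    (hf : Continuous f) (hg : Continuous g) : Continuous fun x => inner B (f x) (g x) :=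
  continuous_inner.comp (hf.prodMk hg)

instance : RightHilbertModule B E.HilbertModule where
  complete := inferInstance
  inner_add_right x y z := by
    induction x, y, z using Completion.induction_on₃ with
    | hp =>
      exact isClosed_eq (continuous_inner_comp (by fun_prop) (by fun_prop))
        ((continuous_inner_comp (by fun_prop) (by fun_prop)).add
          (continuous_inner_comp (by fun_prop) (by fun_prop)))
    | ih x y z => simp only [← Completion.coe_add, inner_coe, PreModule.inner_add_right]
  inner_smul_right c x y := by
    induction x, y using Completion.induction_on₂ with
    | hp =>
      have h1 : Continuous fun p : E.HilbertModule × E.HilbertModule => c • p.2 :=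
        (uniformContinuous_const_smul c).continuous.comp continuous_snd
      have h2 : Continuous fun p : E.HilbertModule × E.HilbertModule =>
          c • inner B p.1 p.2 :=
        (uniformContinuous_const_smul c).continuous.comp
          (continuous_inner_comp continuous_fst continuous_snd)
      exact isClosed_eq (continuous_inner_comp continuous_fst h1) h2
    | ih x y => simp only [← Completion.coe_smul, inner_coe, PreModule.inner_smul_right]
  inner_op_smul_right b x y := by
    induction x, y using Completion.induction_on₂ with
    | hp =>
      exact isClosed_eq (continuous_inner_comp continuous_fst
          ((uniformContinuous_const_smul (MulOpposite.op b)).continuous.comp continuous_snd))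
        ((continuous_inner_comp continuous_fst continuous_snd).mul continuous_const)
    | ih x y => simp only [← Completion.coe_smul, inner_coe, PreModule.inner_op_smul_right]
  star_inner x y := by
    induction x, y using Completion.induction_on₂ with
    | hp =>
      exact isClosed_eq (continuous_inner_comp (by fun_prop) (by fun_prop)).star
        (continuous_inner_comp (by fun_prop) (by fun_prop))
    | ih x y => simp only [inner_coe, PreModule.star_inner]
  inner_self_nonneg x := by
    induction x using Completion.induction_on with
    | hp =>
      have hc : IsClosed {b : B | 0 ≤ b} := CStarAlgebra.isClosed_nonneg
      exact hc.preimage (continuous_inner_comp continuous_id continuous_id)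
    | ih x => simp only [inner_coe, PreModule.inner_self_nonneg]
  norm_sq_eq x := by
    induction x using Completion.induction_on with
    | hp =>
      exact isClosed_eq (by fun_prop) (continuous_inner_comp continuous_id continuous_id).norm
    | ih x => simp only [inner_coe, Completion.norm_coe, PreModule.norm_sq_eq]

/-- The extension to `𝔄` of an adjoint pair of bounded operators on `A`. -/
def extend (T S : E.PreModule →L[ℂ] E.PreModule)
    (h : ∀ x y, inner B (T x) y = inner B x (S y)) :
    RightHilbertModule.Adjointable B E.HilbertModule :=
  ⟨T.completion, S.completion, fun x y => by
    induction x, y using Completion.induction_on₂ with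
    | hp =>
      exact isClosed_eq (continuous_inner_comp (by fun_prop) (by fun_prop))
        (continuous_inner_comp (by fun_prop) (by fun_prop))
    | ih x y => simp only [ContinuousLinearMap.completion_apply_coe, inner_coe, h]⟩

lemma extend_adjoint {T S S' T' : E.PreModule →L[ℂ] E.PreModule}
    (h : ∀ x y, inner B (T x) y = inner B x (S y))
    (h' : ∀ x y, inner B (S' x) y = inner B x (T' y))
    (hS : ∀ x y, inner B (T x) y = inner B x (S' y)) (x y : E.HilbertModule) :
    inner B ((extend T S h).1 x) y = inner B x ((extend S' T' h').1 y) := by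
  induction x, y using Completion.induction_on₂ with
  | hp =>
    exact isClosed_eq
      (continuous_inner_comp (T.completion.continuous.comp continuous_fst) continuous_snd)
      (continuous_inner_comp continuous_fst (S'.completion.continuous.comp continuous_snd))
  | ih x y =>
    change inner B (T.completion x) (y : E.HilbertModule) =
      inner B (x : E.HilbertModule) (S'.completion y)
    simp only [ContinuousLinearMap.completion_apply_coe, inner_coe, hS]

lemma extend_coe (T S : E.PreModule →L[ℂ] E.PreModule)
    (h : ∀ x y, inner B (T x) y = inner B x (S y)) (x : E.PreModule) :
    (extend T S h).1 x = (T x : E.HilbertModule) :=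
  ContinuousLinearMap.completion_apply_coe T x

lemma eta_def (x : A) : E.eta x = (PreModule.of E x : E.HilbertModule) := rfl

lemma inner_eta (x y : A) : inner B (E.eta x) (E.eta y) = E (star x * y) := inner_coe _ _

lemma ext_eta {T S : RightHilbertModule.Adjointable B E.HilbertModule}
    (h : ∀ x : A, T.1 (E.eta x) = S.1 (E.eta x)) : T = S := by
  refine Subtype.ext (ContinuousLinearMap.ext fun x => ?_)
  induction x using Completion.induction_on with
  | hp => exact isClosed_eq (by fun_prop) (by fun_prop)
  | ih x => exact h x

end HilbertModule

namespace PreModule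

/-- Left multiplication by `a` on the semi-inner product module `A`. -/
def leftMul (a : A) : E.PreModule →L[ℂ] E.PreModule :=
  LinearMap.mkContinuous ((of E).toLinearMap ∘ₗ LinearMap.mulLeft ℂ a ∘ₗ (of E).symm.toLinearMap)
    ‖a‖ fun x => norm_le_of_inner_le (norm_nonneg a) (by
      set y := (of E).symm x
      change E (star (a * y) * (a * y)) ≤ ‖a‖ ^ 2 • E (star y * y)
      have h : star (a * y) * (a * y) ≤ ‖a‖ ^ 2 • (star y * y) := by
        have h1 := CStarAlgebra.star_left_conjugate_le_norm_smul (a := y)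
          (IsSelfAdjoint.star_mul_self a)
        rw [CStarRing.norm_star_mul_self, ← sq] at h1
        simpa [mul_assoc] using h1
      rw [← E.toLinearMap.map_smul_of_tower]
      exact E.map_mono h)

lemma leftMul_adjoint (a : A) (x y : E.PreModule) :
    inner B (leftMul E a x) y = inner B x (leftMul E (star a) y) := by
  change E (star (a * (of E).symm x) * (of E).symm y) =
    E (star ((of E).symm x) * (star a * (of E).symm y))
  rw [star_mul, mul_assoc]

lemma map_star_map_mul (x y : A) : E (star (E x : A) * y) = star (E x) * E y := by
  simpa using E.map_mul_left (star (E x)) y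

lemma map_star_mul_map (x y : A) : E (star x * (E y : A)) = star (E x) * E y := by
  rw [map_mul_right, map_star]

/-- The conditional expectation as an operator on the semi-inner product module `A`. -/
def proj : E.PreModule →L[ℂ] E.PreModule :=
  LinearMap.mkContinuous ((of E).toLinearMap ∘ₗ
      ({ toFun := fun x => (E x : A)
         map_add' := fun x y => by simp
         map_smul' := fun c x => by simp } : A →ₗ[ℂ] A) ∘ₗ (of E).symm.toLinearMap)
    1 fun x => norm_le_of_inner_le zero_le_one (by
      set y := (of E).symm x
      change E (star (E y : A) * (E y : A)) ≤ (1 : ℝ) ^ 2 • E (star y * y)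
      have h := E.map_nonneg (star_mul_self_nonneg (y - (E y : A)))
      rw [star_sub, sub_mul, mul_sub, mul_sub, map_sub, map_sub, map_sub, map_star_map_mul,
        map_star_mul_map, map_star_map_mul, map_coe, sub_self, sub_zero, sub_nonneg] at h
      rw [one_pow, one_smul, map_star_map_mul, map_coe]
      exact h)

lemma proj_adjoint (x y : E.PreModule) : inner B (proj E x) y = inner B x (proj E y) := by
  change E (star (E ((of E).symm x) : A) * (of E).symm y) =
    E (star ((of E).symm x) * (E ((of E).symm y) : A))
  rw [map_star_map_mul, map_star_mul_map]

end PreModule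

open RightHilbertModule

instance : CStarRing (Adjointable B E.HilbertModule) := Adjointable.instCStarRing

instance : NormedStarGroup (Adjointable B E.HilbertModule) := Adjointable.instNormedStarGroup

/-- The operator `λ(a)` on `𝔄`, `λ(a) η(x) = η(a x)`. -/
def lamFun (a : A) : Adjointable B E.HilbertModule :=
  HilbertModule.extend (PreModule.leftMul E a) (PreModule.leftMul E (star a))
    (PreModule.leftMul_adjoint E a)

lemma lamFun_eta (a x : A) : (E.lamFun a).1 (E.eta x) = E.eta (a * x) :=
  HilbertModule.extend_coe _ _ _ _

lemma lamFun_smul (c : ℂ) (a : A) : E.lamFun (c • a) = c • E.lamFun a :=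
  HilbertModule.ext_eta fun x => by
    change _ = c • (E.lamFun a).1 (E.eta x)
    rw [lamFun_eta, lamFun_eta, smul_mul_assoc, _root_.map_smul]

lemma lamFun_add (a b : A) : E.lamFun (a + b) = E.lamFun a + E.lamFun b :=
  HilbertModule.ext_eta fun x => by
    change _ = (E.lamFun a).1 (E.eta x) + (E.lamFun b).1 (E.eta x)
    rw [lamFun_eta, lamFun_eta, lamFun_eta, add_mul, _root_.map_add]

lemma lamFun_mul (a b : A) : E.lamFun (a * b) = E.lamFun a * E.lamFun b :=
  HilbertModule.ext_eta fun x => by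
    change _ = (E.lamFun a).1 ((E.lamFun b).1 (E.eta x))
    rw [lamFun_eta, lamFun_eta, lamFun_eta, mul_assoc]

lemma lamFun_zero : E.lamFun 0 = 0 := by
  simpa using E.lamFun_smul 0 0

lemma lamFun_star (a : A) : E.lamFun (star a) = star (E.lamFun a) := by
  refine (Adjointable.star_eq_of_inner (HilbertModule.extend_adjoint _ _ fun x y => ?_)).symm
  exact PreModule.leftMul_adjoint E a x y

/-- The left regular representation `λ : A → L_B(𝔄)`, `λ(a) η(x) = η(a x)`. -/
def lam : A →⋆ₙₐ[ℂ] Adjointable B E.HilbertModule where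
  toFun := E.lamFun
  map_smul' := E.lamFun_smul
  map_zero' := E.lamFun_zero
  map_add' := E.lamFun_add
  map_mul' := E.lamFun_mul
  map_star' := E.lamFun_star

lemma lam_eta (a x : A) : (E.lam a).1 (E.eta x) = E.eta (a * x) := E.lamFun_eta a x

/-- The Jones projection `e_E ∈ L_B(𝔄)`, `e_E η(x) = η(E(x))`. -/
def jones : Adjointable B E.HilbertModule :=
  HilbertModule.extend (PreModule.proj E) (PreModule.proj E) (PreModule.proj_adjoint E)

lemma jones_eta (x : A) : E.jones.1 (E.eta x) = E.eta (E x : A) :=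
  HilbertModule.extend_coe _ _ _ _

lemma star_jones : star E.jones = E.jones :=
  Adjointable.star_eq_of_inner (HilbertModule.extend_adjoint _ _ (PreModule.proj_adjoint E))

lemma jones_mul_jones : E.jones * E.jones = E.jones := HilbertModule.ext_eta fun x => by
  change E.jones.1 (E.jones.1 (E.eta x)) = _
  rw [jones_eta, jones_eta, map_coe]

lemma jones_mul_lam_mul_jones (a : A) :
    E.jones * E.lam a * E.jones = E.lam (E a) * E.jones := HilbertModule.ext_eta fun x => by
  change E.jones.1 ((E.lam a).1 (E.jones.1 (E.eta x))) = (E.lam (E a)).1 (E.jones.1 (E.eta x))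
  rw [jones_eta, lam_eta, jones_eta, lam_eta, map_mul_right]
  rfl

/-- The span of the operators `λ(x) e_E λ(y)`, which is a ⋆-subalgebra of `L_B(𝔄)`. -/
def basicConstructionSpan : NonUnitalStarSubalgebra ℂ (Adjointable B E.HilbertModule) where
  __ := Submodule.span ℂ {T | ∃ x y : A, T = E.lam x * E.jones * E.lam y}
  mul_mem' {S T} hS hT := by
    change S * T ∈ Submodule.span ℂ {T | ∃ x y : A, T = E.lam x * E.jones * E.lam y}
    induction hS, hT using Submodule.span_induction₂ with
    | mem_mem S T hS hT =>
      obtain ⟨x, y, rfl⟩ := hS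
      obtain ⟨z, w, rfl⟩ := hT
      refine Submodule.subset_span ⟨x * E (y * z), w, ?_⟩
      rw [map_mul, mul_assoc (E.lam x) (E.lam _), ← jones_mul_lam_mul_jones, map_mul]
      simp only [mul_assoc]
    | zero_left T hT => simp
    | zero_right S hS => simp
    | add_left S S' T _ _ _ h h' => rw [add_mul]; exact add_mem h h'
    | add_right S T T' _ _ _ h h' => rw [mul_add]; exact add_mem h h'
    | smul_left c S T _ _ h => rw [smul_mul_assoc]; exact Submodule.smul_mem _ _ h
    | smul_right c S T _ _ h => rw [mul_smul_comm]; exact Submodule.smul_mem _ _ h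
  star_mem' {S} hS := by
    change star S ∈ Submodule.span ℂ {T | ∃ x y : A, T = E.lam x * E.jones * E.lam y}
    induction hS using Submodule.span_induction with
    | mem S hS =>
      obtain ⟨x, y, rfl⟩ := hS
      refine Submodule.subset_span ⟨star y, star x, ?_⟩
      rw [star_mul, star_mul, star_jones, StarHomClass.map_star, StarHomClass.map_star, mul_assoc]
    | zero => simp
    | add S T _ _ h h' => rw [star_add]; exact add_mem h h'
    | smul c S _ h => rw [star_smul]; exact Submodule.smul_mem _ _ h

/-- The reduced C⋆-basic construction `C⋆_r⟨A, e_E⟩`: the norm closure in `L_B(𝔄)` of the span of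
the operators `λ(x) e_E λ(y)`. -/
def basicConstruction : NonUnitalStarSubalgebra ℂ (Adjointable B E.HilbertModule) :=
  E.basicConstructionSpan.topologicalClosure

end ConditionalExpectation

end

/-!
Finite probabilistic index says `a⋆ a ≤ γ E(a⋆ a)` for all `a`. Together with the contractivity of
`E` on positive elements (`norm_map_le_of_nonneg`) this makes the module norm `‖E(a⋆ a)‖ ^ (1/2)`
equivalent to the norm of `A`, so that `A` is already complete in it and `η` is a bijection
onto `𝔄`.

The remaining assertions rest on the factorization `A = A B`. If `a⋆ a ≤ γ c⁴` with `c`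
self-adjoint, then `a = x c` for some `x` (`exists_eq_mul_of_star_mul_self_le`): with regularized
inverses `yₙ = c (c² + sₙ²)⁻¹`, the elements `a yₙ` form a Cauchy sequence, since the domination
bounds `‖a z‖` by a multiple of `‖c² z‖` and `c² yₙ` converges to `c`; the limit is the quotient.
Apply this to the fourth root `c` of `E(a⋆ a)`, an element of `B`.

From `A = A B`, and `A = B A` by taking adjoints, approximate units pass from `B` to `A`. Since
`λ(B)` commutes with `e_E`, writing `a = x b` gives `λ(a) e_E = λ(x) e_E λ(b)`, which lies in the
basic construction. If `λ(a)` commutes with `e_E`, evaluating at `η(b)` gives `(a - E(a)) b = 0`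
for all `b ∈ B`, hence `a = E(a) ∈ B`. Finally `b ↦ λ(b) e_E` is injective because
`λ(b) e_E η(b⋆) = η(b b⋆)`.
-/

/-! ### Factorization below a positive element -/

/-- Regularized inverses: `c² y ≈ c` for the element `y = c (c² + s²)⁻¹`. -/
lemma exists_norm_mul_mul_sub_le {A : Type*} [NonUnitalCStarAlgebra A] (c : A)
    (hc : IsSelfAdjoint c) {s : ℝ} (hs : 0 < s) : ∃ y : A, ‖c * c * y - c‖ ≤ s := by
  have hpos : ∀ t : ℝ, 0 < t ^ 2 + s ^ 2 := fun t => by positivity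
  have hcont : ContinuousOn (fun t : ℝ => t / (t ^ 2 + s ^ 2)) (quasispectrum ℝ c) :=
    (continuous_id.div (by fun_prop) fun t => (hpos t).ne').continuousOn
  refine ⟨cfcₙ (fun t : ℝ => t / (t ^ 2 + s ^ 2)) c, ?_⟩
  have h1 : c * c * cfcₙ (fun t : ℝ => t / (t ^ 2 + s ^ 2)) c - c =
      cfcₙ (fun t : ℝ => t * t * (t / (t ^ 2 + s ^ 2)) - t) c := by
    rw [cfcₙ_sub (fun t : ℝ => t * t * (t / (t ^ 2 + s ^ 2))) (fun t => t) c
        (by fun_prop) (by simp) (by fun_prop) (by simp),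
      cfcₙ_mul (fun t : ℝ => t * t) (fun t => t / (t ^ 2 + s ^ 2)) c
        (by fun_prop) (by simp) (by fun_prop) (by simp),
      cfcₙ_mul (fun t : ℝ => t) (fun t => t) c, cfcₙ_id' ℝ c]
  rw [h1]
  refine norm_cfcₙ_le fun t _ => ?_
  have h2 : t * t * (t / (t ^ 2 + s ^ 2)) - t = -(s * (s * t) / (t ^ 2 + s ^ 2)) := by
    have := (hpos t).ne'
    field_simp
    ring
  rw [h2, norm_neg, norm_div, Real.norm_of_nonneg (hpos t).le, div_le_iff₀ (hpos t), norm_mul,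
    Real.norm_of_nonneg hs.le]
  gcongr
  rw [Real.norm_eq_abs, abs_le]
  constructor <;> nlinarith [sq_nonneg (s + t), sq_nonneg (s - t), sq_nonneg s, sq_nonneg t]

section Factorization

variable {A : Type*} [NonUnitalCStarAlgebra A] [PartialOrder A] [StarOrderedRing A]

lemma norm_mul_sq_le_of_star_mul_self_le {a h : A} {γ : ℝ} (hγ : 0 ≤ γ)
    (H : star a * a ≤ γ • (star h * h)) (y : A) : ‖a * y‖ ^ 2 ≤ γ * ‖h * y‖ ^ 2 := by
  have h1 : star (a * y) * (a * y) ≤ γ • (star (h * y) * (h * y)) := by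
    simpa [mul_assoc, mul_smul_comm, smul_mul_assoc] using star_left_conjugate_le_conjugate H y
  have h2 := CStarAlgebra.norm_le_norm_of_nonneg_of_le (star_mul_self_nonneg _) h1
  rwa [norm_smul, CStarRing.norm_star_mul_self, CStarRing.norm_star_mul_self,
    Real.norm_of_nonneg hγ, ← sq, ← sq] at h2

/-- If `a⋆ a ≤ γ c⁴`, then `a` is divisible by `c` on the right. The quotient is the limit of
`a yₙ`, where `c² yₙ → c`. -/
lemma exists_eq_mul_of_star_mul_self_le {a c : A} {γ : ℝ} (hγ : 0 ≤ γ) (hc : IsSelfAdjoint c)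
    (H : star a * a ≤ γ • (star (c * c) * (c * c))) : ∃ x : A, a = x * c := by
  have key := norm_mul_sq_le_of_star_mul_self_le hγ H
  choose y hy using fun n : ℕ =>
    exists_norm_mul_mul_sub_le c hc (Nat.one_div_pos_of_nat (α := ℝ) (n := n))
  have hlim : Filter.Tendsto (fun n => c * c * y n) Filter.atTop (nhds c) :=
    tendsto_iff_norm_sub_tendsto_zero.2
      (squeeze_zero (fun _ => norm_nonneg _) hy tendsto_one_div_add_atTop_nhds_zero_nat)
  have hle : ∀ z : A, ‖a * z‖ ≤ √γ * ‖c * c * z‖ := fun z => by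
    refine le_of_sq_le_sq ?_ (by positivity)
    rw [mul_pow, Real.sq_sqrt hγ]
    exact key z
  have hcau : CauchySeq fun n => a * y n := by
    have h1 := hlim.cauchySeq
    rw [Metric.cauchySeq_iff] at h1 ⊢
    intro ε hε
    obtain ⟨N, hN⟩ := h1 (ε / (√γ + 1)) (by positivity)
    refine ⟨N, fun m hm n hn => ?_⟩
    have h2 := hN m hm n hn
    rw [dist_eq_norm, ← mul_sub, lt_div_iff₀ (by positivity)] at h2
    rw [dist_eq_norm, ← mul_sub]
    nlinarith [hle (y m - y n), norm_nonneg (c * c * (y m - y n))]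
  obtain ⟨x, hx⟩ := cauchySeq_tendsto_of_complete hcau
  refine ⟨x, ?_⟩
  -- The defect `d = x c - a` satisfies `d c = 0`, because `c² y c - c² → 0`.
  have hdc : (x * c - a) * c = 0 := by
    have h1 : Filter.Tendsto (fun n => a * y n * c * c - a * c) Filter.atTop
        (nhds (x * c * c - a * c)) := ((hx.mul_const c).mul_const c).sub_const _
    have h2 : Filter.Tendsto (fun n => √γ * ‖c * c * y n * c * c - c * c * c‖) Filter.atTop
        (nhds (√γ * ‖c * c * c - c * c * c‖)) :=
      ((((hlim.mul_const c).mul_const c).sub_const _).norm).const_mul _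
    rw [sub_self, norm_zero, mul_zero] at h2
    rw [sub_mul]
    refine tendsto_nhds_unique h1 (squeeze_zero_norm (fun n => ?_) h2)
    simpa only [mul_sub, mul_assoc] using hle (y n * c * c - c)
  have hcd : c * star (x * c - a) = 0 := by
    simpa [hc.star_eq] using congrArg star hdc
  -- Hence `a d⋆ = 0` by domination, and therefore `d d⋆ = 0`.
  have had : a * star (x * c - a) = 0 := by
    have h1 := hle (star (x * c - a))
    rwa [mul_assoc c c, hcd, mul_zero, norm_zero, mul_zero, norm_le_zero_iff] at h1
  have hdd : (x * c - a) * star (x * c - a) = 0 := by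
    rw [sub_mul, mul_assoc, hcd, had, mul_zero, sub_zero]
  exact (sub_eq_zero.1 (CStarRing.mul_star_self_eq_zero_iff _ |>.1 hdd)).symm

end Factorization

/-! ### Consequences of finite probabilistic index -/

namespace ConditionalExpectation

variable {A : Type*} [NonUnitalCStarAlgebra A] [PartialOrder A] [StarOrderedRing A]
  {B : NonUnitalStarSubalgebra ℂ A} [IsClosed (B : Set A)] (E : ConditionalExpectation B)

/-- The contractivity of `E` on positive elements follows from the Kadison–Schwarz inequality
`E(a)⋆ E(a) ≤ E(a⋆ a)`. -/
lemma norm_map_le_of_nonneg {a : A} (ha : 0 ≤ a) : ‖E a‖ ≤ ‖a‖ := by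
  -- The Jones projection has norm at most one on `E.PreModule`: this is Kadison–Schwarz.
  have h1 : ‖E a‖ ^ 2 ≤ ‖E (a * a)‖ := by
    have h := (PreModule.proj (E := E)).le_of_opNorm_le
      (LinearMap.mkContinuous_norm_le _ zero_le_one _) (PreModule.of E a)
    rw [one_mul] at h
    have h' := pow_le_pow_left₀ (norm_nonneg _) h 2
    rw [PreModule.norm_sq_eq, PreModule.norm_sq_eq] at h'
    change ‖E (star (E a : A) * (E a : A))‖ ≤ ‖E (star a * a)‖ at h'
    rw [PreModule.map_star_map_mul, map_coe, CStarRing.norm_star_mul_self, ← sq,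
      (IsSelfAdjoint.of_nonneg ha).star_eq] at h'
    exact h'
  have h2 : ‖E (a * a)‖ ≤ ‖a‖ * ‖E a‖ := by
    have h3 : a * a ≤ ‖a‖ • a := by
      have hs : star (CFC.sqrt a) = CFC.sqrt a := (CFC.sqrt_nonneg a).isSelfAdjoint.star_eq
      have h := CStarAlgebra.star_left_conjugate_le_norm_smul (a := CFC.sqrt a) (.of_nonneg ha)
      rw [hs, CFC.sqrt_mul_sqrt_self a ha] at h
      refine le_of_eq_of_le ?_ h
      calc a * a = CFC.sqrt a * CFC.sqrt a * (CFC.sqrt a * CFC.sqrt a) := by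
            rw [CFC.sqrt_mul_sqrt_self a ha]
        _ = CFC.sqrt a * (CFC.sqrt a * CFC.sqrt a) * CFC.sqrt a := by simp only [mul_assoc]
        _ = _ := by rw [CFC.sqrt_mul_sqrt_self a ha]
    have h4 := E.map_mono h3
    rw [E.toLinearMap.map_smul_of_tower] at h4
    have h5 := CStarAlgebra.norm_le_norm_of_nonneg_of_le
      (E.map_nonneg (by
        simpa [(IsSelfAdjoint.of_nonneg ha).star_eq] using star_mul_self_nonneg a)) h4
    rwa [norm_smul, norm_norm] at h5
  rcases (norm_nonneg (E a)).eq_or_lt with h | h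
  · rw [← h]; exact norm_nonneg a
  · nlinarith

lemma norm_of_le (a : A) : ‖PreModule.of E a‖ ≤ ‖a‖ := by
  refine le_of_sq_le_sq ?_ (norm_nonneg a)
  rw [PreModule.norm_sq_eq, sq ‖a‖, ← CStarRing.norm_star_mul_self]
  exact E.norm_map_le_of_nonneg (star_mul_self_nonneg a)

variable {E}

lemma HasFiniteProbabilisticIndex.exists_norm_le (hE : E.HasFiniteProbabilisticIndex) :
    ∃ C : NNReal, ∀ a : A, ‖a‖ ≤ C * ‖PreModule.of E a‖ := by
  obtain ⟨γ, hγ, H⟩ := hE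
  have hγ0 : 0 ≤ γ := zero_le_one.trans hγ
  refine ⟨(√γ).toNNReal, fun a => ?_⟩
  rw [Real.coe_toNNReal _ (Real.sqrt_nonneg γ)]
  refine le_of_sq_le_sq ?_ (mul_nonneg (Real.sqrt_nonneg γ) (norm_nonneg _))
  have h := CStarAlgebra.norm_le_norm_of_nonneg_of_le (star_mul_self_nonneg a)
    (sub_nonneg.1 (H _ (star_mul_self_nonneg a)))
  rw [CStarRing.norm_star_mul_self, norm_smul, Real.norm_of_nonneg hγ0] at h
  rw [mul_pow, Real.sq_sqrt hγ0, PreModule.norm_sq_eq, sq]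
  exact h

lemma HasFiniteProbabilisticIndex.antilipschitz_of (hE : E.HasFiniteProbabilisticIndex) :
    ∃ C : NNReal, AntilipschitzWith C (PreModule.of E) := by
  obtain ⟨C, hC⟩ := hE.exists_norm_le
  exact ⟨C, AddMonoidHomClass.antilipschitz_of_bound (PreModule.of E) hC⟩

lemma norm_eta (a : A) : ‖E.eta a‖ = ‖PreModule.of E a‖ :=
  UniformSpace.Completion.norm_coe _

lemma HasFiniteProbabilisticIndex.eta_injective (hE : E.HasFiniteProbabilisticIndex) :
    Function.Injective E.eta := by
  obtain ⟨C, hC⟩ := hE.exists_norm_le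
  refine (injective_iff_map_eq_zero E.eta).2 fun a ha => norm_le_zero_iff.1 ?_
  have h := hC a
  rwa [← norm_eta, ha, norm_zero, mul_zero] at h

lemma HasFiniteProbabilisticIndex.completeSpace (hE : E.HasFiniteProbabilisticIndex) :
    CompleteSpace E.PreModule := by
  obtain ⟨C, hC⟩ := hE.antilipschitz_of
  have hL : LipschitzWith 1 (PreModule.of E) :=
    AddMonoidHomClass.lipschitz_of_bound_nnnorm (PreModule.of E) 1 fun a => by
      rw [one_mul]
      exact E.norm_of_le a
  exact ((hC.isUniformInducing hL.uniformContinuous).completeSpace_congr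
    (PreModule.of E).surjective).1 inferInstance

lemma HasFiniteProbabilisticIndex.range_eta (hE : E.HasFiniteProbabilisticIndex) :
    Set.range E.eta = Set.univ := by
  have := hE.completeSpace
  have h1 : Set.range E.eta = Set.range ((↑) : E.PreModule → E.HilbertModule) := rfl
  have h2 : IsClosed (Set.range ((↑) : E.PreModule → E.HilbertModule)) :=
    ((UniformSpace.Completion.isUniformInducing_coe E.PreModule).isComplete_range).isClosed
  rw [h1, ← h2.closure_eq, UniformSpace.Completion.denseRange_coe.closure_range]

/-- Pimsner–Popa domination `a⋆ a ≤ γ E(a⋆ a)` makes `a` divisible by the fourth root of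
`E(a⋆ a)`, which lies in `B`. -/
lemma HasFiniteProbabilisticIndex.exists_eq_mul_coe (hE : E.HasFiniteProbabilisticIndex) (a : A) :
    ∃ x : A, ∃ b : B, a = x * b := by
  obtain ⟨γ, hγ, H⟩ := hE
  set d : B := E (star a * a)
  have hd : 0 ≤ d := E.map_nonneg (star_mul_self_nonneg a)
  set c : B := CFC.sqrt (CFC.sqrt d)
  have hc : IsSelfAdjoint c := (CFC.sqrt_nonneg _).isSelfAdjoint
  have hcc : c * c = CFC.sqrt d := CFC.sqrt_mul_sqrt_self _ (CFC.sqrt_nonneg d)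
  have hd4 : star (c * c) * (c * c) = d := by
    rw [hcc, (CFC.sqrt_nonneg d).isSelfAdjoint.star_eq, CFC.sqrt_mul_sqrt_self d hd]
  obtain ⟨x, hx⟩ := exists_eq_mul_of_star_mul_self_le (a := a) (c := c) (zero_le_one.trans hγ)
    (congrArg Subtype.val hc) (by
      have h : star ((c : A) * c) * ((c : A) * c) = (d : A) := congrArg Subtype.val hd4
      rw [h]
      exact sub_nonneg.1 (H _ (star_mul_self_nonneg a)))
  exact ⟨x, c, hx⟩

lemma HasFiniteProbabilisticIndex.exists_eq_coe_mul (hE : E.HasFiniteProbabilisticIndex) (a : A) :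
    ∃ b : B, ∃ x : A, a = b * x := by
  obtain ⟨x, b, h⟩ := hE.exists_eq_mul_coe (star a)
  exact ⟨star b, star x, by simpa using congrArg star h⟩

lemma HasFiniteProbabilisticIndex.isApproximateUnit_map (hE : E.HasFiniteProbabilisticIndex)
    {l : Filter B} (hl : l.IsApproximateUnit) :
    (l.map ((↑) : B → A)).IsApproximateUnit where
  tendsto_mul_left a := by
    obtain ⟨x, b, rfl⟩ := hE.exists_eq_mul_coe a
    rw [Filter.tendsto_map'_iff]
    have h := (continuous_subtype_val.tendsto b).comp (hl.tendsto_mul_left b)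
    simpa [Function.comp_def, mul_assoc] using h.const_mul x
  tendsto_mul_right a := by
    obtain ⟨b, x, rfl⟩ := hE.exists_eq_coe_mul a
    rw [Filter.tendsto_map'_iff]
    have h := (continuous_subtype_val.tendsto b).comp (hl.tendsto_mul_right b)
    simpa [Function.comp_def, mul_assoc] using h.mul_const x
  neBot := hl.neBot.map _

/-- The left annihilator of `B` in `A` vanishes, since `A = B A`. -/
lemma HasFiniteProbabilisticIndex.eq_zero_of_forall_mul_coe
    (hE : E.HasFiniteProbabilisticIndex) {a : A} (h : ∀ b : B, a * b = 0) : a = 0 := by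
  obtain ⟨b, x, hx⟩ := hE.exists_eq_coe_mul (star a)
  rw [← CStarRing.mul_star_self_eq_zero_iff, hx, ← mul_assoc, h, zero_mul]

/-! ### The Jones projection and the basic construction -/

variable (E)

lemma jones_mul_lam_coe (b : B) : E.jones * E.lam (b : A) = E.lam (b : A) * E.jones :=
  HilbertModule.ext_eta fun x => by
    change E.jones.1 ((E.lam (b : A)).1 (E.eta x)) = (E.lam (b : A)).1 (E.jones.1 (E.eta x))
    rw [lam_eta, jones_eta, jones_eta, lam_eta, map_mul_left]
    rfl

lemma lam_mul_jones_mul_lam_mem (x y : A) :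
    E.lam x * E.jones * E.lam y ∈ E.basicConstruction :=
  NonUnitalStarSubalgebra.le_topologicalClosure _ (Submodule.subset_span ⟨x, y, rfl⟩)

variable {E}

lemma HasFiniteProbabilisticIndex.lam_mul_jones_mem (hE : E.HasFiniteProbabilisticIndex) (a : A) :
    E.lam a * E.jones ∈ E.basicConstruction := by
  obtain ⟨x, b, rfl⟩ := hE.exists_eq_mul_coe a
  rw [map_mul, mul_assoc, ← jones_mul_lam_coe, ← mul_assoc]
  exact E.lam_mul_jones_mul_lam_mem x b

lemma HasFiniteProbabilisticIndex.jones_mul_lam_mem (hE : E.HasFiniteProbabilisticIndex) (a : A) :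
    E.jones * E.lam a ∈ E.basicConstruction := by
  obtain ⟨b, x, rfl⟩ := hE.exists_eq_coe_mul a
  rw [map_mul, ← mul_assoc, jones_mul_lam_coe]
  exact E.lam_mul_jones_mul_lam_mem b x

lemma HasFiniteProbabilisticIndex.mem_of_commute_jones (hE : E.HasFiniteProbabilisticIndex) {a : A}
    (h : E.jones * E.lam a = E.lam a * E.jones) : a ∈ B := by
  have h1 : ∀ b : B, (a - E a) * b = 0 := fun b => by
    have h2 := congrArg (fun T => T.1 (E.eta b)) h
    change E.jones.1 ((E.lam a).1 (E.eta b)) = (E.lam a).1 (E.jones.1 (E.eta b)) at h2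
    rw [lam_eta, jones_eta, jones_eta, lam_eta, map_mul_right, map_coe] at h2
    rw [sub_mul, sub_eq_zero]
    exact (hE.eta_injective h2).symm
  rw [sub_eq_zero.1 (hE.eq_zero_of_forall_mul_coe h1)]
  exact (E a).2

lemma HasFiniteProbabilisticIndex.centralizer_inter_range
    (hE : E.HasFiniteProbabilisticIndex) :
    Set.centralizer {E.jones} ∩ Set.range E.lam = E.lam '' (B : Set A) := by
  ext T
  simp only [Set.mem_inter_iff, Set.mem_centralizer_iff, Set.mem_singleton_iff, forall_eq]
  constructor
  · rintro ⟨h, a, rfl⟩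
    exact ⟨a, hE.mem_of_commute_jones h, rfl⟩
  · rintro ⟨b, hb, rfl⟩
    exact ⟨E.jones_mul_lam_coe ⟨b, hb⟩, b, rfl⟩

/-- The corner embedding `b ↦ λ(b) e_E` of `B` into the basic construction. It is multiplicative
and ⋆-preserving because `e_E` is a projection commuting with `λ(B)`. -/
noncomputable def HasFiniteProbabilisticIndex.corner (hE : E.HasFiniteProbabilisticIndex) :
    B →⋆ₙₐ[ℂ] E.basicConstruction where
  toFun b := ⟨E.lam (b : A) * E.jones, hE.lam_mul_jones_mem b⟩
  map_smul' c b := Subtype.ext (by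
    change E.lam (c • (b : A)) * E.jones = c • (E.lam (b : A) * E.jones)
    rw [_root_.map_smul, smul_mul_assoc])
  map_zero' := Subtype.ext (by
    change E.lam (0 : A) * E.jones = 0
    rw [map_zero, zero_mul])
  map_add' b c := Subtype.ext (by
    change E.lam ((b : A) + c) * E.jones = E.lam (b : A) * E.jones + E.lam (c : A) * E.jones
    rw [map_add, add_mul])
  map_mul' b c := Subtype.ext (by
    change E.lam ((b : A) * c) * E.jones =
      (E.lam (b : A) * E.jones) * (E.lam (c : A) * E.jones)
    rw [map_mul, mul_assoc (E.lam (b : A)), ← jones_mul_lam_coe E c, mul_assoc (E.lam (b : A)),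
      ← mul_assoc E.jones E.jones, jones_mul_jones])
  map_star' b := Subtype.ext (by
    change E.lam (star (b : A)) * E.jones = star (E.lam (b : A) * E.jones)
    rw [star_mul, star_jones, ← StarHomClass.map_star]
    exact (E.jones_mul_lam_coe (star b)).symm)

lemma HasFiniteProbabilisticIndex.corner_injective (hE : E.HasFiniteProbabilisticIndex) :
    Function.Injective hE.corner := by
  refine (injective_iff_map_eq_zero hE.corner).2 fun b hb => ?_
  have h1 : E.lam (b : A) * E.jones = 0 := congrArg Subtype.val hb
  have h2 := congrArg (fun T => T.1 (E.eta (star b : B))) h1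
  change (E.lam (b : A)).1 (E.jones.1 (E.eta (star b : B))) = 0 at h2
  rw [jones_eta, map_coe, lam_eta] at h2
  have h3 : (b : A) * star (b : A) = 0 := hE.eta_injective (h2.trans (map_zero E.eta).symm)
  exact Subtype.ext ((CStarRing.mul_star_self_eq_zero_iff _).1 h3)

end ConditionalExpectation

theorem mainTheorem8 {A : Type*} [NonUnitalCStarAlgebra A] [PartialOrder A] [StarOrderedRing A]
    (B : NonUnitalStarSubalgebra ℂ A) [IsClosed (B : Set A)] (E : ConditionalExpectation B)
    (hE : E.HasFiniteProbabilisticIndex) :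
    -- `η` is a (linear) contraction
    (∀ a : A, ‖E.eta a‖ ≤ ‖a‖) ∧
    -- `A` itself is already a Hilbert `B`-module: `A` embeds in its completion `𝔄`, the inner
    -- product norm on `A` is complete, and `𝔄 = η(A)`
    (Function.Injective E.eta ∧ CompleteSpace E.PreModule ∧ Set.range E.eta = Set.univ) ∧
    -- `A = A B`, and approximate identities of `B` are approximate identities of `A`
    ((∀ a : A, ∃ x : A, ∃ b : B, a = x * b) ∧
      (∀ l : Filter B, l.IsApproximateUnit → (l.map ((↑) : B → A)).IsApproximateUnit) ∧
      ∀ l : Filter B, l.IsIncreasingApproximateUnit →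
        (l.map ((↑) : B → A)).IsIncreasingApproximateUnit) ∧
    -- `{e_E}' ∩ λ(A) = λ(B)` in `L_B(𝔄)`
    Set.centralizer {E.jones} ∩ Set.range E.lam = E.lam '' (B : Set A) ∧
    -- `λ(A) e_E` and `e_E λ(A)` lie in the basic construction
    (∀ a : A, E.lam a * E.jones ∈ E.basicConstruction ∧
      E.jones * E.lam a ∈ E.basicConstruction) ∧
    -- `b ↦ λ(b) e_E` is an injective ⋆-homomorphism from `B` to the basic construction
    ∃ ψ : B →⋆ₙₐ[ℂ] E.basicConstruction,
      (∀ b : B, (ψ b : RightHilbertModule.Adjointable B E.HilbertModule) =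
        E.lam (b : A) * E.jones) ∧ Function.Injective ψ := by
  refine ⟨fun a => (ConditionalExpectation.norm_eta a).trans_le (E.norm_of_le a),
    ⟨hE.eta_injective, hE.completeSpace, hE.range_eta⟩,
    ⟨hE.exists_eq_mul_coe, fun l hl => hE.isApproximateUnit_map hl, fun l hl => ?_⟩,
    hE.centralizer_inter_range,
    fun a => ⟨hE.lam_mul_jones_mem a, hE.jones_mul_lam_mem a⟩,
    hE.corner, fun b => rfl, hE.corner_injective⟩
  exact
    { hE.isApproximateUnit_map hl.toIsApproximateUnit with
      eventually_nonneg := hl.eventually_nonneg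
      eventually_norm := hl.eventually_norm }
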